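/- All rings are commutative with unity, and local rings are Noetherian. Let $B$ be a local ring containing an infinite field $K$, and let $T=\widehat{B}$ be the completion of $B$ at its maximal ideal. Suppose that $T/I$ is a regular local ring for every minimal prime ideal $I$ of $T$. Let $P_1,\dots,P_m$ be the distinct minimal prime ideals of $B$. Let $n$ be a positive integer, let $y$ and $z$ be indeterminates, let $A=B[[y,z]]$, and put $P_j'=(P_j,y,z)A$ for $j=1,\dots,m$. Then there are distinct elements $\beta_1,\dots,\beta_n$ of $K$ such that the ideals $Q_i=(P_1,\,y+\beta_i z)A$, $i=1,\dots,n$, are distinct prime ideals of $A$ with the following properties. 1. For every $i=1,\dots,n$ and $j=1,\dots,m$, we have $Q_i\subseteq P_j'$ if and only if $j=1$. 2. For every $i=1,\dots,n$, the ideal $P_1'/Q_i$ of the ring $A/Q_i$ is a prime ideal of height one. 3. If $J=\left(\bigcap_{i=1}^{n}Q_i\right)\cap P_2'\cap\cdots\cap P_m'$, then $S=A/J$ is a local ring and, for every minimal prime ideal $Q$ of its completion $\widehat{S}$ at its maximal ideal, $\widehat{S}/Q$ is a regular local ring. -/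

import Mathlib

/-- The completion of the local ring `R` at its maximal ideal, modulo each of its minimal prime
ideals, is a regular local ring. -/
def CompletionModMinimalPrimesRegular (R : Type*) [CommRing R] [IsLocalRing R]
    [IsNoetherianRing R] : Prop :=
  ∀ I ∈ minimalPrimes (AdicCompletion (IsLocalRing.maximalIdeal R) R),
    IsRegularLocalRing (AdicCompletion (IsLocalRing.maximalIdeal R) R ⧸ I)

/-- The power series ring `B[[y, z]]`; the variables are `y = X 0` and `z = X 1`. -/
abbrev PowerSeriesYZ (B : Type*) [CommRing B] : Type _ := MvPowerSeries (Fin 2) B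

/-- The ideal `(P, y, z)` of `B[[y, z]]`. -/
noncomputable def idealPYZ {B : Type*} [CommRing B] (P : Ideal B) : Ideal (PowerSeriesYZ B) :=
  P.map (MvPowerSeries.C : B →+* PowerSeriesYZ B) ⊔
    Ideal.span {MvPowerSeries.X 0, MvPowerSeries.X 1}

/-- The ideal `(P, y + b z)` of `B[[y, z]]`. -/
noncomputable def idealPLine {B : Type*} [CommRing B] (P : Ideal B) (b : B) :
    Ideal (PowerSeriesYZ B) :=
  P.map (MvPowerSeries.C : B →+* PowerSeriesYZ B) ⊔
    Ideal.span {MvPowerSeries.X 0 + MvPowerSeries.C b * MvPowerSeries.X 1}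

/-!
With `T` the completion of `B`, the completion of `A = B[[y, z]]` is `T[[y, z]]`, so the completion
of `A / J` is `T[[y, z]] / J T[[y, z]]`. Since `J` is a finite intersection, a minimal prime over
`J T[[y, z]]` is minimal over the extension of some `Q_i` or `P_j'`, and hence is `(q, y + b z)` or
`(q, y, z)` for a prime `q` minimal over `P_j T`. Going down for the flat extension `B → T` shows
that `q` is a minimal prime of `T`, and the quotient by `(q, y + b z)` or `(q, y, z)` is
`(T / q)[[z]]` or `T / q`, which is regular.
-/

theorem isPrecomplete_of_surjective {R M N : Type*} [CommRing R] [AddCommGroup M] [Module R M]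
    [AddCommGroup N] [Module R N] (I : Ideal R) [IsPrecomplete I M] {f : M →ₗ[R] N}
    (hf : Function.Surjective f) : IsPrecomplete I N := by
  rw [← AdicCompletion.of_surjective_iff]
  intro y
  obtain ⟨x, rfl⟩ := AdicCompletion.map_surjective I hf y
  obtain ⟨m, rfl⟩ := AdicCompletion.of_surjective I M x
  exact ⟨f m, (AdicCompletion.map_of I f m).symm⟩

theorem isAdicComplete_map_of_surjective {S S' : Type*} [CommRing S] [CommRing S']
    [IsNoetherianRing S] (I : Ideal S) [IsAdicComplete I S] {ρ : S →+* S'}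
    (hρ : Function.Surjective ρ) : IsAdicComplete (I.map ρ) S' := by
  algebraize [ρ]
  have : Module.Finite S S' := .of_surjective (Algebra.linearMap S S') hρ
  have : IsHausdorff I S' := .of_le_jacobson I S' (IsAdicComplete.le_jacobson_bot I)
  have : IsPrecomplete I S' := isPrecomplete_of_surjective I (f := Algebra.linearMap S S') hρ
  exact (IsAdicComplete.map_algebraMap_iff I S').2 ⟨⟩

theorem factorPow_comp_evalₐ {R : Type*} [CommRing R] (I : Ideal R) {m n : ℕ} (hmn : m ≤ n) :
    (Ideal.Quotient.factorPow I hmn).comp (AdicCompletion.evalₐ I n).toRingHom =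
      (AdicCompletion.evalₐ I m).toRingHom := by
  refine RingHom.ext fun x ↦ ?_
  obtain ⟨x, rfl⟩ := AdicCompletion.mk_surjective I R x
  simpa [AdicCompletion.evalₐ_mk] using AdicCompletion.Ideal.mk_eq_mk I hmn x

/-- The ring homomorphism `f : R → S` exhibits `S` as the `I`-adic completion of `R`: the ring `S`
is complete for the extension of `I`, and `R / I ^ n → S / I ^ n S` is injective and surjective for
every `n`, which the last two fields say in terms of elements. Unlike with `AdicCompletion`, the
ring `S` may be any model of the completion. -/
structure IsAdicCompletionMap {R S : Type*} [CommRing R] [CommRing S] (f : R →+* S)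
    (I : Ideal R) : Prop where
  isAdicComplete : IsAdicComplete (I.map f) S
  mem_pow_of_map_mem : ∀ n x, f x ∈ I.map f ^ n → x ∈ I ^ n
  exists_sub_mem_pow : ∀ n s, ∃ r, s - f r ∈ I.map f ^ n

namespace IsAdicCompletionMap

theorem algebraMap_adicCompletion {R : Type*} [CommRing R] {I : Ideal R} (hI : I.FG) :
    IsAdicCompletionMap (algebraMap R (AdicCompletion I R)) I := by
  have mem_pow_iff (n : ℕ) (x : AdicCompletion I R) :
      x ∈ I.map (algebraMap R (AdicCompletion I R)) ^ n ↔ AdicCompletion.eval I R n x = 0 := by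
    rw [← LinearMap.mem_ker, ← AdicCompletion.pow_smul_top_eq_ker_eval hI, ← Ideal.map_pow,
      Ideal.smul_top_eq_map]
    rfl
  refine ⟨AdicCompletion.isAdicComplete_self I hI, fun n x hx ↦ ?_, fun n s ↦ ?_⟩
  · rw [mem_pow_iff, AdicCompletion.algebraMap_apply] at hx
    have hx : Ideal.Quotient.mk (I ^ n • ⊤ : Ideal R) x = 0 := hx
    simpa [Ideal.Quotient.eq_zero_iff_mem] using hx
  · obtain ⟨r, hr⟩ := Ideal.Quotient.mk_surjective (AdicCompletion.eval I R n s)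
    refine ⟨r, ?_⟩
    rw [mem_pow_iff, map_sub, sub_eq_zero, ← hr, AdicCompletion.algebraMap_apply]
    rfl

variable {R S R' S' : Type*} [CommRing R] [CommRing S] [CommRing R'] [CommRing S']
  {f : R →+* S} {I : Ideal R}

/-- The isomorphism `R / I ^ n ≃ S / I ^ n S` induced by a completion map `R → S`. -/
noncomputable def quotientPowEquiv (h : IsAdicCompletionMap f I) (n : ℕ) :
    R ⧸ I ^ n ≃+* S ⧸ I.map f ^ n :=
  RingEquiv.ofBijective
    (Ideal.quotientMap (I.map f ^ n) f (Ideal.map_pow f I n ▸ Ideal.le_comap_map)) <| by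
    refine ⟨Ideal.quotientMap_injective' (h.mem_pow_of_map_mem n), fun s ↦ ?_⟩
    obtain ⟨s, rfl⟩ := Ideal.Quotient.mk_surjective s
    obtain ⟨r, hr⟩ := h.exists_sub_mem_pow n s
    exact ⟨Ideal.Quotient.mk _ r, by
      simpa using (Ideal.Quotient.mk_eq_mk_iff_sub_mem _ _).2 hr |>.symm⟩

theorem factorPow_comp_quotientPowEquiv (h : IsAdicCompletionMap f I) {m n : ℕ} (hmn : m ≤ n) :
    (Ideal.Quotient.factorPow (I.map f) hmn).comp (h.quotientPowEquiv n).toRingHom =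
      (h.quotientPowEquiv m).toRingHom.comp (Ideal.Quotient.factorPow I hmn) :=
  Ideal.Quotient.ringHom_ext <| RingHom.ext fun _ ↦ rfl

/-- The projection `S → R / I ^ n` of a model `S` of the `I`-adic completion of `R`. -/
noncomputable def toQuotientPow (h : IsAdicCompletionMap f I) (n : ℕ) : S →+* R ⧸ I ^ n :=
  (h.quotientPowEquiv n).symm.toRingHom.comp (Ideal.Quotient.mk (I.map f ^ n))

theorem toQuotientPow_eq_iff (h : IsAdicCompletionMap f I) {n : ℕ} {s : S} {x : R ⧸ I ^ n} :
    h.toQuotientPow n s = x ↔ Ideal.Quotient.mk _ s = h.quotientPowEquiv n x :=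
  (h.quotientPowEquiv n).symm_apply_eq

theorem factorPow_comp_toQuotientPow (h : IsAdicCompletionMap f I) {m n : ℕ} (hmn : m ≤ n) :
    (Ideal.Quotient.factorPow I hmn).comp (h.toQuotientPow n) = h.toQuotientPow m := by
  ext s
  rw [eq_comm, toQuotientPow_eq_iff]
  have := congr($(h.factorPow_comp_quotientPowEquiv hmn) (h.toQuotientPow n s))
  refine Eq.trans ?_ this
  simp [toQuotientPow]

/-- The map from a model `S` of the `I`-adic completion of `R` to `AdicCompletion I R`. -/
noncomputable def toAdicCompletion (h : IsAdicCompletionMap f I) : S →+* AdicCompletion I R :=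
  AdicCompletion.liftRingHom I h.toQuotientPow h.factorPow_comp_toQuotientPow

theorem evalₐ_toAdicCompletion (h : IsAdicCompletionMap f I) (n : ℕ) (s : S) :
    AdicCompletion.evalₐ I n (h.toAdicCompletion s) = h.toQuotientPow n s :=
  AdicCompletion.evalₐ_liftRingHom I h.toQuotientPow h.factorPow_comp_toQuotientPow n s

theorem toAdicCompletion_bijective (h : IsAdicCompletionMap f I) :
    Function.Bijective h.toAdicCompletion := by
  have := h.isAdicComplete
  refine ⟨(injective_iff_map_eq_zero _).2 fun s hs ↦ ?_, fun x ↦ ?_⟩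
  · refine IsHausdorff.haus (I := I.map f) inferInstance s fun n ↦ ?_
    have hn := h.evalₐ_toAdicCompletion n s
    rw [hs, map_zero, eq_comm, toQuotientPow_eq_iff, map_zero] at hn
    rwa [SModEq.zero, smul_eq_mul, Ideal.mul_top, ← Ideal.Quotient.eq_zero_iff_mem]
  · let t : AdicCompletion I R →+* S := IsAdicComplete.liftRingHom (I.map f)
      (fun n ↦ (h.quotientPowEquiv n).toRingHom.comp (AdicCompletion.evalₐ I n).toRingHom)
      fun hmn ↦ by
        rw [← RingHom.comp_assoc, factorPow_comp_quotientPowEquiv, RingHom.comp_assoc,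
          factorPow_comp_evalₐ I hmn]
    refine ⟨t x, AdicCompletion.ext_evalₐ fun n ↦ ?_⟩
    rw [evalₐ_toAdicCompletion, toQuotientPow_eq_iff]
    exact IsAdicComplete.mk_liftRingHom (I.map f) _ _ n x

/-- Any model of the `I`-adic completion of `R` is isomorphic to `AdicCompletion I R`. -/
noncomputable def adicCompletionEquiv (h : IsAdicCompletionMap f I) : S ≃+* AdicCompletion I R :=
  .ofBijective h.toAdicCompletion h.toAdicCompletion_bijective

theorem exists_mem_sub_mem_pow (h : IsAdicCompletionMap f I) {K : Ideal R} {s : S}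
    (hs : s ∈ K.map f) (n : ℕ) : ∃ r ∈ K, s - f r ∈ I.map f ^ n := by
  induction hs using Submodule.span_induction with
  | mem s hs =>
    obtain ⟨r, hr, rfl⟩ := hs
    exact ⟨r, hr, by simp⟩
  | zero => exact ⟨0, K.zero_mem, by simp⟩
  | add s t _ _ hs ht =>
    obtain ⟨r, hrK, hr⟩ := hs
    obtain ⟨q, hqK, hq⟩ := ht
    exact ⟨r + q, K.add_mem hrK hqK, by
      simpa only [map_add, add_sub_add_comm] using add_mem hr hq⟩
  | smul t s _ hs =>
    obtain ⟨r, hrK, hr⟩ := hs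
    obtain ⟨q, hq⟩ := h.exists_sub_mem_pow n t
    refine ⟨q * r, K.mul_mem_left q hrK, ?_⟩
    have : t • s - f (q * r) = t * (s - f r) + (t - f q) * f r := by
      rw [smul_eq_mul, map_mul]
      ring
    rw [this]
    exact add_mem (Ideal.mul_mem_left _ _ hr) (Ideal.mul_mem_right _ _ hq)

theorem of_surjective [IsNoetherianRing S] (h : IsAdicCompletionMap f I) {π : R →+* R'}
    {ρ : S →+* S'} {f' : R' →+* S'} (hcomm : f'.comp π = ρ.comp f)
    (hπ : Function.Surjective π) (hρ : Function.Surjective ρ)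
    (hker : RingHom.ker ρ ≤ (RingHom.ker π).map f) : IsAdicCompletionMap f' (I.map π) := by
  have hcomm_apply (r : R) : f' (π r) = ρ (f r) := congr($hcomm r)
  have hmap : (I.map π).map f' = (I.map f).map ρ := by
    rw [Ideal.map_map, hcomm, ← Ideal.map_map]
  refine ⟨?_, fun n x hx ↦ ?_, fun n s' ↦ ?_⟩
  · have := h.isAdicComplete
    exact hmap ▸ isAdicComplete_map_of_surjective (I.map f) hρ
  · obtain ⟨r, rfl⟩ := hπ x
    rw [hmap, ← Ideal.map_pow, hcomm_apply, Ideal.mem_map_iff_of_surjective ρ hρ] at hx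
    obtain ⟨s, hs, hsr⟩ := hx
    obtain ⟨k, hk, hkn⟩ := h.exists_mem_sub_mem_pow
      (hker ((RingHom.sub_mem_ker_iff ρ).2 hsr.symm)) n
    have hrk : r - k ∈ I ^ n := h.mem_pow_of_map_mem n _ <| by
      rw [map_sub]
      convert add_mem hkn hs using 1
      ring
    rw [← Ideal.map_pow, ← sub_zero (π r), ← (RingHom.mem_ker).1 hk, ← map_sub]
    exact Ideal.mem_map_of_mem π hrk
  · obtain ⟨s, rfl⟩ := hρ s'
    obtain ⟨r, hr⟩ := h.exists_sub_mem_pow n s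
    refine ⟨π r, ?_⟩
    rw [hmap, ← Ideal.map_pow, hcomm_apply, ← map_sub]
    exact Ideal.mem_map_of_mem ρ hr

end IsAdicCompletionMap

theorem isNoetherianRing_adicCompletion {R : Type*} [CommRing R] [IsNoetherianRing R]
    (I : Ideal R) : IsNoetherianRing (AdicCompletion I R) := by
  -- Sending the variables to generators of `I` makes `R` a quotient of `R[x₁, …, xₙ]`, hence its
  -- completion a quotient of the completion `R[[x₁, …, xₙ]]` of the polynomial ring.
  obtain ⟨n, a, ha⟩ := Submodule.fg_iff_exists_fin_generating_family.1
    (IsNoetherian.noetherian I)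
  let π : MvPolynomial (Fin n) R →+* R := (MvPolynomial.aeval a).toRingHom
  have hπ : Function.Surjective π := fun r ↦ ⟨MvPolynomial.C r, by simp [π]⟩
  have hI : (MvPolynomial.idealOfVars (Fin n) R).map π = I := by
    rw [← ha, MvPolynomial.idealOfVars, Ideal.map_span, ← Set.range_comp]
    congr 2
    ext i
    simp [π]
  let f := algebraMap (MvPolynomial (Fin n) R)
    (AdicCompletion (MvPolynomial.idealOfVars (Fin n) R) (MvPolynomial (Fin n) R))
  have hf : IsAdicCompletionMap f (MvPolynomial.idealOfVars (Fin n) R) :=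
    .algebraMap_adicCompletion (MvPolynomial.idealOfVars_fg (Fin n) R)
  have := isNoetherianRing_of_ringEquiv (MvPowerSeries (Fin n) R)
    (MvPowerSeries.toAdicCompletionAlgEquiv (Fin n) R).toRingEquiv
  have hquot := hf.of_surjective (ρ := Ideal.Quotient.mk ((RingHom.ker π).map f))
    (f' := (Ideal.quotientMap _ f Ideal.le_comap_map).comp
      (RingHom.quotientKerEquivOfSurjective hπ).symm.toRingHom)
    (RingHom.ext fun r ↦ by simp) hπ Ideal.Quotient.mk_surjective (Ideal.mk_ker).le
  rw [hI] at hquot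
  exact isNoetherianRing_of_ringEquiv _ hquot.adicCompletionEquiv

section MvPowerSeries

open MvPowerSeries

variable {σ R S : Type*} [CommRing R] [CommRing S]

theorem exists_eq_C_add_sum_X_mul [Fintype σ] (f : MvPowerSeries σ R) :
    ∃ g : σ → MvPowerSeries σ R, f = C (constantCoeff f) + ∑ i, X i * g i ∧
      ∀ i d, coeff d (g i) = coeff (d + Finsupp.single i 1) f ∨ coeff d (g i) = 0 := by
  classical
  have exists_ne_zero (d : σ →₀ ℕ) (hd : d ≠ 0) : ∃ i, d i ≠ 0 := DFunLike.ne_iff.1 hd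
  choose v hv using exists_ne_zero
  -- `X i * g i` collects the nonconstant monomials to which the variable `i` is assigned by `v`.
  let g (i : σ) : MvPowerSeries σ R := fun d ↦
    if v (d + Finsupp.single i 1) (by simp) = i then coeff (d + Finsupp.single i 1) f else 0
  have coeff_g (i : σ) (d : σ →₀ ℕ) : coeff d (g i) =
    if v (d + Finsupp.single i 1) (by simp) = i then coeff (d + Finsupp.single i 1) f else 0 := rfl
  refine ⟨g, ?_, fun i d ↦ ?_⟩
  · ext d
    have coeff_X_mul_g (i : σ) : coeff d (X i * g i) =
        if h : d ≠ 0 then if v d h = i then coeff d f else 0 else 0 := by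
      by_cases hi : d i = 0
      · rw [X, coeff_monomial_mul, if_neg (by simp [hi])]
        split_ifs with hd hvd
        · exact absurd hi (hvd ▸ hv d hd)
        · rfl
        · rfl
      · obtain ⟨e, rfl⟩ : ∃ e, d = e + Finsupp.single i 1 :=
          ⟨d - Finsupp.single i 1, (tsub_add_cancel_of_le (by simpa [Nat.one_le_iff_ne_zero])).symm⟩
        rw [add_comm e, X, coeff_add_monomial_mul, one_mul, coeff_g, dif_pos (by simp)]
        simp only [add_comm e]
    rw [map_add, map_sum, coeff_C]
    simp only [coeff_X_mul_g]
    split_ifs with hd <;> simp_all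
  · rw [coeff_g]
    split_ifs <;> simp

theorem comap_constantCoeff_eq [Finite σ] (I : Ideal R) :
    I.comap (constantCoeff (σ := σ)) = I.map C ⊔ Ideal.span (Set.range X) := by
  cases nonempty_fintype σ
  refine le_antisymm (fun f hf ↦ ?_) (sup_le (Ideal.map_le_iff_le_comap.2 fun x hx ↦ ?_) ?_)
  · obtain ⟨g, hfg, -⟩ := exists_eq_C_add_sum_X_mul f
    rw [hfg]
    exact add_mem (Ideal.mem_sup_left (Ideal.mem_map_of_mem _ hf)) <| Ideal.mem_sup_right <|
      sum_mem fun i _ ↦ Ideal.mul_mem_right _ _ (Ideal.subset_span ⟨i, rfl⟩)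
  · simpa using hx
  · rw [Ideal.span_le]
    rintro _ ⟨i, rfl⟩
    simp

theorem coeff_mem_pow_of_mem_comap_constantCoeff_pow {I : Ideal R} {n : ℕ} {f : MvPowerSeries σ R}
    (hf : f ∈ I.comap (constantCoeff (σ := σ)) ^ n) (d : σ →₀ ℕ) :
    coeff d f ∈ I ^ (n - d.degree) := by
  classical
  induction n generalizing f d with
  | zero => simp
  | succ n ih =>
    rw [pow_succ] at hf
    refine Submodule.mul_induction_on hf (fun a ha b hb ↦ ?_) fun a b ha hb ↦ ?_
    · rw [coeff_mul]
      refine Ideal.sum_mem _ fun ⟨u, v⟩ huv ↦ ?_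
      have hb' : coeff v b ∈ I ^ (1 - v.degree) := by
        by_cases hv : v = 0
        · subst hv
          simpa using hb
        · have : v.degree ≠ 0 := (Finsupp.degree_eq_zero_iff v).not.2 hv
          simp [show 1 - v.degree = 0 by lia]
      have hd : d.degree = u.degree + v.degree := by
        rw [← Finset.HasAntidiagonal.mem_antidiagonal.1 huv, map_add]
      exact Ideal.pow_le_pow_right (by lia) (pow_add I _ _ ▸ Ideal.mul_mem_mul (ih ha u) hb')
    · rw [map_add]
      exact add_mem ha hb

theorem mem_comap_constantCoeff_pow_iff [Finite σ] {I : Ideal R} {n : ℕ} {f : MvPowerSeries σ R} :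
    f ∈ I.comap (constantCoeff (σ := σ)) ^ n ↔ ∀ d, coeff d f ∈ I ^ (n - d.degree) := by
  cases nonempty_fintype σ
  refine ⟨coeff_mem_pow_of_mem_comap_constantCoeff_pow, fun h ↦ ?_⟩
  induction n generalizing f with
  | zero => simp
  | succ n ih =>
    obtain ⟨g, hfg, hg⟩ := exists_eq_C_add_sum_X_mul f
    rw [hfg]
    refine add_mem ?_ (sum_mem fun i _ ↦ ?_)
    · have : I.map (C (σ := σ)) ≤ I.comap constantCoeff := by
        rw [comap_constantCoeff_eq]
        exact le_sup_left
      refine Ideal.pow_right_mono this _ ?_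
      rw [← Ideal.map_pow]
      exact Ideal.mem_map_of_mem _ (by simpa using h 0)
    · rw [pow_succ']
      refine Ideal.mul_mem_mul (by simp) (ih fun d ↦ ?_)
      obtain hgd | hgd := hg i d
      · rw [hgd]
        have hd := h (d + Finsupp.single i 1)
        rwa [map_add, Finsupp.degree_single, Nat.add_sub_add_right] at hd
      · rw [hgd]
        exact zero_mem _

theorem map_comap_constantCoeff [Finite σ] (f : R →+* S) (I : Ideal R) :
    (I.comap (constantCoeff (σ := σ))).map (MvPowerSeries.map f) =
      (I.map f).comap constantCoeff := by
  have hC : (MvPowerSeries.map f).comp C = (C (σ := σ)).comp f := by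
    ext1
    simp
  rw [comap_constantCoeff_eq, comap_constantCoeff_eq, Ideal.map_sup, Ideal.map_map, hC,
    ← Ideal.map_map, Ideal.map_span, ← Set.range_comp]
  congr 3
  ext1 i
  simp

theorem isAdicComplete_comap_constantCoeff [Finite σ] (I : Ideal R) [IsAdicComplete I R] :
    IsAdicComplete (I.comap (constantCoeff (σ := σ))) (MvPowerSeries σ R) where
  haus' f hf := by
    ext d
    refine IsHausdorff.haus (I := I) inferInstance _ fun n ↦ ?_
    have := hf (n + d.degree)
    rw [SModEq.zero, smul_eq_mul, Ideal.mul_top, mem_comap_constantCoeff_pow_iff] at this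
    rw [SModEq.zero, smul_eq_mul, Ideal.mul_top]
    simpa using this d
  prec' f hf := by
    simp only [SModEq.sub_mem, smul_eq_mul, Ideal.mul_top, mem_comap_constantCoeff_pow_iff,
      map_sub] at hf ⊢
    have exists_coeff_limit (d : σ →₀ ℕ) :
        ∃ c : R, ∀ n, coeff d (f (n + d.degree)) - c ∈ I ^ n := by
      obtain ⟨c, hc⟩ := IsPrecomplete.prec (I := I) (M := R) inferInstance
        (f := fun n ↦ coeff d (f (n + d.degree))) fun {m n} hmn ↦ by
          rw [SModEq.sub_mem, smul_eq_mul, Ideal.mul_top]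
          simpa using hf (Nat.add_le_add_right hmn d.degree) d
      exact ⟨c, fun n ↦ by simpa [SModEq.sub_mem] using hc n⟩
    choose c hc using exists_coeff_limit
    refine ⟨c, fun n d ↦ ?_⟩
    obtain hd | hd := le_total n d.degree
    · simp [Nat.sub_eq_zero_of_le hd]
    · have := hc d (n - d.degree)
      rwa [Nat.sub_add_cancel hd] at this

theorem IsAdicCompletionMap.mvPowerSeries [Finite σ] {f : R →+* S} {I : Ideal R}
    (h : IsAdicCompletionMap f I) :
    IsAdicCompletionMap (MvPowerSeries.map (σ := σ) f) (I.comap constantCoeff) where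
  isAdicComplete := by
    have := h.isAdicComplete
    rw [map_comap_constantCoeff]
    exact isAdicComplete_comap_constantCoeff _
  mem_pow_of_map_mem n x hx := by
    rw [map_comap_constantCoeff, mem_comap_constantCoeff_pow_iff] at hx
    rw [mem_comap_constantCoeff_pow_iff]
    exact fun d ↦ h.mem_pow_of_map_mem _ _ (by simpa using hx d)
  exists_sub_mem_pow n s := by
    choose r hr using fun d : σ →₀ ℕ ↦ h.exists_sub_mem_pow (n - d.degree) (coeff d s)
    refine ⟨r, ?_⟩
    rw [map_comap_constantCoeff, mem_comap_constantCoeff_pow_iff]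
    exact hr

theorem ker_mvPowerSeries_map_mk {I : Ideal R} (hI : I.FG) :
    RingHom.ker (MvPowerSeries.map (σ := σ) (Ideal.Quotient.mk I)) = I.map C := by
  refine le_antisymm (fun f hf ↦ ?_) (Ideal.map_le_iff_le_comap.2 fun x hx ↦ ?_)
  · have coeff_mem (d : σ →₀ ℕ) : coeff d f ∈ I := by
      rw [← Ideal.Quotient.eq_zero_iff_mem, ← coeff_map, (RingHom.mem_ker).1 hf, map_zero]
    obtain ⟨n, a, rfl⟩ := Submodule.fg_iff_exists_fin_generating_family.1 hI
    choose c hc using fun d ↦ (Submodule.mem_span_range_iff_exists_fun R).1 (coeff_mem d)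
    let g (i : Fin n) : MvPowerSeries σ R := fun d ↦ c d i
    have coeff_g (i : Fin n) (d : σ →₀ ℕ) : coeff d (g i) = c d i := rfl
    have hf_eq : f = ∑ i, g i * C (a i) := by
      ext d
      simp [coeff_g, ← hc, coeff_mul_C]
    rw [hf_eq]
    exact sum_mem fun i _ ↦ Ideal.mul_mem_left _ _
      (Ideal.mem_map_of_mem _ (Submodule.subset_span ⟨i, rfl⟩))
  · simp [RingHom.mem_ker, Ideal.Quotient.eq_zero_iff_mem.2 hx]

theorem comap_constantCoeff_maximalIdeal [IsLocalRing R] :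
    (IsLocalRing.maximalIdeal R).comap (constantCoeff (σ := σ)) =
      IsLocalRing.maximalIdeal (MvPowerSeries σ R) := by
  ext f
  rw [Ideal.mem_comap, IsLocalRing.mem_maximalIdeal, IsLocalRing.mem_maximalIdeal,
    mem_nonunits_iff, mem_nonunits_iff, isUnit_iff_constantCoeff]

end MvPowerSeries

theorem isRegularLocalRing_powerSeries (R : Type*) [CommRing R] [IsRegularLocalRing R] :
    IsRegularLocalRing (PowerSeries R) := by
  have hX : (PowerSeries.X : PowerSeries R) ∈ IsLocalRing.maximalIdeal (PowerSeries R) := by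
    rw [IsLocalRing.mem_maximalIdeal, mem_nonunits_iff, PowerSeries.isUnit_iff_constantCoeff]
    simp
  have hrank := PowerSeries.spanFinrank_le_spanFinrank_map_constantCoeff_add_one_of_X_mem hX
  rw [IsLocalRing.map_maximalIdeal_of_surjective _ PowerSeries.constantCoeff_surj] at hrank
  apply IsRegularLocalRing.of_spanFinrank_maximalIdeal_le
  calc ((IsLocalRing.maximalIdeal (PowerSeries R)).spanFinrank : WithBot ℕ∞)
      ≤ (IsLocalRing.maximalIdeal R).spanFinrank + 1 := by exact_mod_cast hrank
    _ = ringKrullDim R + 1 := by rw [IsRegularLocalRing.spanFinrank_maximalIdeal]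
    _ ≤ ringKrullDim (PowerSeries R) := ringKrullDim_succ_le_ringKrullDim_powerseries

namespace PowerSeriesYZ

open MvPowerSeries

variable {R : Type*} [CommRing R]

theorem hasSubst_shear (b : R) :
    HasSubst (![X 0 + C b * X 1, X 1] : Fin 2 → PowerSeriesYZ R) :=
  hasSubst_of_constantCoeff_zero fun i ↦ by fin_cases i <;> simp

/-- The substitution `y ↦ y + b z`, `z ↦ z`. -/
noncomputable def shear (b : R) : PowerSeriesYZ R →ₐ[R] PowerSeriesYZ R :=
  substAlgHom (hasSubst_shear b)

theorem shear_X_zero (b : R) : shear b (X 0) = X 0 + C b * X 1 :=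
  substAlgHom_X (hasSubst_shear b) 0

theorem shear_X_one (b : R) : shear b (X 1) = X 1 :=
  substAlgHom_X (hasSubst_shear b) 1

theorem shear_C (b r : R) : shear b (C r) = C r :=
  (shear b).commutes r

theorem shear_zero : shear (0 : R) = AlgHom.id R (PowerSeriesYZ R) := by
  ext1 f
  have : (![X 0 + C 0 * X 1, X 1] : Fin 2 → PowerSeriesYZ R) = X := by
    ext1 i
    fin_cases i <;> simp
  rw [shear, substAlgHom_apply, this, subst_self, id, AlgHom.id_apply]

theorem shear_comp_shear (b c : R) : (shear c).comp (shear b) = shear (b + c) := by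
  ext1 f
  have : (fun i ↦ shear c (![X 0 + C b * X 1, X 1] i)) =
      (![X 0 + C (b + c) * X 1, X 1] : Fin 2 → PowerSeriesYZ R) := by
    ext1 i
    fin_cases i
    · simp only [Fin.zero_eta, Matrix.cons_val_zero, map_add, map_mul, shear_X_zero, shear_X_one,
        shear_C]
      ring
    · exact shear_X_one c
  rw [AlgHom.comp_apply, shear, shear, substAlgHom_comp_substAlgHom_apply, shear,
    substAlgHom_apply, substAlgHom_apply]
  exact congr(subst $this f)

/-- The substitution `y ↦ y + b z`, `z ↦ z`, with inverse `y ↦ y - b z`, `z ↦ z`. -/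
noncomputable def shearEquiv (b : R) : PowerSeriesYZ R ≃ₐ[R] PowerSeriesYZ R :=
  .ofAlgHom (shear b) (shear (-b)) (by rw [shear_comp_shear, neg_add_cancel, shear_zero])
    (by rw [shear_comp_shear, add_neg_cancel, shear_zero])

/-- The restriction `f(y, z) ↦ f(0, z)` of a power series to the line `y = 0`. -/
noncomputable def setYZero : PowerSeriesYZ R →ₐ[R] PowerSeries R :=
  killCompl ⟨fun _ : Unit ↦ (1 : Fin 2), Function.injective_of_subsingleton _⟩

theorem setYZero_surjective : Function.Surjective (setYZero (R := R)) :=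
  fun g ↦ ⟨rename _ g, killCompl_rename_app g⟩

theorem setYZero_X_one : setYZero (X 1 : PowerSeriesYZ R) = PowerSeries.X :=
  killCompl_X (e := ⟨fun _ : Unit ↦ (1 : Fin 2), Function.injective_of_subsingleton _⟩) ()

theorem ker_setYZero : RingHom.ker (setYZero (R := R)) = Ideal.span {X 0} := by
  ext f
  rw [RingHom.mem_ker, Ideal.mem_span_singleton, X_dvd_iff, MvPowerSeries.ext_iff]
  refine ⟨fun h m hm ↦ ?_, fun h m ↦ ?_⟩
  · have := h (Finsupp.single () (m 1))
    rw [setYZero, coeff_killCompl, Finsupp.embDomain_single] at this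
    convert! this
    ext i
    fin_cases i <;> simp [hm]
  · rw [setYZero, coeff_killCompl]
    exact h _ (Finsupp.embDomain_of_notMem_range _ _ _ (by simp))

/-- The restriction `f(y, z) ↦ f(-b z, z)` of a power series to the line `y + b z = 0`. -/
noncomputable def evalLine (b : R) : PowerSeriesYZ R →+* PowerSeries R :=
  (setYZero.comp (shearEquiv b).symm.toAlgHom).toRingHom

theorem evalLine_surjective (b : R) : Function.Surjective (evalLine b) :=
  setYZero_surjective.comp (shearEquiv b).symm.surjective

theorem evalLine_X_one (b : R) : evalLine b (X 1) = PowerSeries.X :=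
  (congrArg setYZero (shear_X_one (-b))).trans setYZero_X_one

theorem evalLine_comp_C (b : R) : (evalLine b).comp C = PowerSeries.C :=
  RingHom.ext (setYZero.comp (shearEquiv b).symm.toAlgHom).commutes

theorem ker_evalLine (b : R) : RingHom.ker (evalLine b) = Ideal.span {X 0 + C b * X 1} := by
  ext f
  have mem_ker_iff : f ∈ RingHom.ker (evalLine b) ↔
      (shearEquiv b).symm f ∈ RingHom.ker (setYZero (R := R)) := Iff.rfl
  rw [mem_ker_iff, ker_setYZero, Ideal.mem_span_singleton, Ideal.mem_span_singleton,
    ← shear_X_zero, ← map_dvd_iff (shearEquiv b), AlgEquiv.apply_symm_apply]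
  rfl

/-- The restriction of a power series to the line `y + b z = 0`, with coefficients reduced
modulo `I`. -/
noncomputable def evalLineMod (I : Ideal R) (b : R) : PowerSeriesYZ R →+* PowerSeries (R ⧸ I) :=
  (PowerSeries.map (Ideal.Quotient.mk I)).comp (evalLine b)

theorem evalLineMod_surjective (I : Ideal R) (b : R) : Function.Surjective (evalLineMod I b) :=
  (PowerSeries.map_surjective _ Ideal.Quotient.mk_surjective).comp (evalLine_surjective b)

theorem evalLineMod_X_one (I : Ideal R) (b : R) : evalLineMod I b (X 1) = PowerSeries.X := by
  simp [evalLineMod, evalLine_X_one]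

theorem evalLineMod_C (I : Ideal R) (b r : R) :
    evalLineMod I b (C r) = PowerSeries.C (Ideal.Quotient.mk I r) := by
  rw [evalLineMod, RingHom.comp_apply, ← RingHom.comp_apply (evalLine b), evalLine_comp_C,
    PowerSeries.map_C]

theorem ker_evalLineMod {I : Ideal R} (hI : I.FG) (b : R) :
    RingHom.ker (evalLineMod I b) = idealPLine I b := by
  have hker : RingHom.ker (PowerSeries.map (Ideal.Quotient.mk I)) =
      (I.map (C : R →+* PowerSeriesYZ R)).map (evalLine b) := by
    rw [Ideal.map_map, evalLine_comp_C]
    exact ker_mvPowerSeries_map_mk hI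
  rw [evalLineMod, ← RingHom.comap_ker, hker,
    Ideal.comap_map_of_surjective _ (evalLine_surjective b), ← RingHom.ker_eq_comap_bot,
    ker_evalLine, idealPLine]

end PowerSeriesYZ

section idealPLine

open MvPowerSeries PowerSeriesYZ

variable {R S : Type*} [CommRing R] [CommRing S]

theorem idealPYZ_eq_comap (I : Ideal R) : idealPYZ I = I.comap constantCoeff := by
  rw [comap_constantCoeff_eq, idealPYZ]
  congr 2
  ext x
  simp [Fin.exists_fin_two, eq_comm]

theorem map_idealPYZ (f : R →+* S) (I : Ideal R) :
    (idealPYZ I).map (MvPowerSeries.map f) = idealPYZ (I.map f) := by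
  rw [idealPYZ_eq_comap, idealPYZ_eq_comap, map_comap_constantCoeff]

theorem map_idealPLine (f : R →+* S) (I : Ideal R) (b : R) :
    (idealPLine I b).map (MvPowerSeries.map f) = idealPLine (I.map f) (f b) := by
  have hC : (MvPowerSeries.map f).comp C = (C (σ := Fin 2)).comp f := by
    ext1
    simp
  rw [idealPLine, Ideal.map_sup, Ideal.map_map, hC, ← Ideal.map_map, Ideal.map_span]
  simp [idealPLine]

theorem isPrime_idealPYZ (I : Ideal R) [I.IsPrime] : (idealPYZ I).IsPrime := by
  rw [idealPYZ_eq_comap]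
  infer_instance

theorem isPrime_idealPLine {I : Ideal R} [I.IsPrime] (hI : I.FG) (b : R) :
    (idealPLine I b).IsPrime := by
  rw [← ker_evalLineMod hI]
  exact RingHom.ker_isPrime _

theorem isRegularLocalRing_quotient_idealPYZ (I : Ideal R) [IsRegularLocalRing (R ⧸ I)] :
    IsRegularLocalRing (PowerSeriesYZ R ⧸ idealPYZ I) := by
  let ε : PowerSeriesYZ R →+* R ⧸ I := (Ideal.Quotient.mk I).comp constantCoeff
  have hε : Function.Surjective ε :=
    Ideal.Quotient.mk_surjective.comp fun r ↦ ⟨C r, constantCoeff_C r⟩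
  have hker : RingHom.ker ε = idealPYZ I := by
    rw [idealPYZ_eq_comap, ← RingHom.comap_ker, Ideal.mk_ker]
  rw [← hker]
  exact .of_ringEquiv (RingHom.quotientKerEquivOfSurjective hε).symm

theorem isRegularLocalRing_quotient_idealPLine {I : Ideal R} [IsRegularLocalRing (R ⧸ I)]
    (hI : I.FG) (b : R) : IsRegularLocalRing (PowerSeriesYZ R ⧸ idealPLine I b) := by
  rw [← ker_evalLineMod hI]
  have := isRegularLocalRing_powerSeries (R ⧸ I)
  exact .of_ringEquiv (RingHom.quotientKerEquivOfSurjective (evalLineMod_surjective I b)).symm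

theorem X_one_notMem_idealPLine {I : Ideal R} (hI : I.FG) (hI' : I ≠ ⊤) (b : R) :
    X 1 ∉ idealPLine I b := by
  have := Ideal.Quotient.nontrivial_iff.2 hI'
  rw [← ker_evalLineMod hI, RingHom.mem_ker, evalLineMod_X_one]
  exact PowerSeries.X_ne_zero

theorem sub_mem_of_idealPLine_le_idealPLine {I J : Ideal R} (hJ : J.FG) {a b : R}
    (h : idealPLine I a ≤ idealPLine J b) : a - b ∈ J := by
  have mem_idealPLine (I : Ideal R) (b : R) : X 0 + C b * X 1 ∈ idealPLine I b :=
    Ideal.mem_sup_right (Ideal.mem_span_singleton_self _)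
  have hmem : C (a - b) * X 1 ∈ idealPLine J b := by
    convert sub_mem (h (mem_idealPLine I a)) (mem_idealPLine J b) using 1
    rw [map_sub]
    ring
  rw [← ker_evalLineMod hJ, RingHom.mem_ker, map_mul, evalLineMod_X_one, evalLineMod_C] at hmem
  rw [← Ideal.Quotient.eq_zero_iff_mem]
  simpa only [PowerSeries.coeff_C_mul, PowerSeries.coeff_one_X, mul_one, map_zero]
    using congr(PowerSeries.coeff 1 $hmem)

theorem idealPLine_le_idealPYZ_iff {I J : Ideal R} {b : R} :
    idealPLine I b ≤ idealPYZ J ↔ I ≤ J := by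
  rw [idealPYZ_eq_comap, idealPLine, sup_le_iff, Ideal.map_le_iff_le_comap,
    Ideal.span_singleton_le_iff_mem, Ideal.comap_comap, constantCoeff_comp_C, Ideal.comap_id]
  simp

theorem idealPYZ_eq_idealPLine_sup (I : Ideal R) (b : R) :
    idealPYZ I = idealPLine I b ⊔ Ideal.span {X 1} := by
  rw [idealPYZ, idealPLine, sup_assoc, ← Ideal.span_union, Set.singleton_union]
  congr 1
  exact (Ideal.span_pair_add_mul_right _ _ (C b)).symm

theorem map_mk_idealPYZ (I : Ideal R) (b : R) :
    (idealPYZ I).map (Ideal.Quotient.mk (idealPLine I b)) =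
      Ideal.span {Ideal.Quotient.mk (idealPLine I b) (X 1)} := by
  rw [idealPYZ_eq_idealPLine_sup I b, Ideal.map_sup, Ideal.map_quotient_self, bot_sup_eq,
    Ideal.map_span, Set.image_singleton]

theorem isPrime_map_mk_idealPYZ (I : Ideal R) [I.IsPrime] (b : R) :
    ((idealPYZ I).map (Ideal.Quotient.mk (idealPLine I b))).IsPrime := by
  have := isPrime_idealPYZ I
  refine Ideal.map_isPrime_of_surjective Ideal.Quotient.mk_surjective ?_
  rw [Ideal.mk_ker]
  exact idealPLine_le_idealPYZ_iff.2 le_rfl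

theorem height_map_mk_idealPYZ [IsNoetherianRing R] (I : Ideal R) [I.IsPrime] (b : R) :
    ((idealPYZ I).map (Ideal.Quotient.mk (idealPLine I b))).height = 1 := by
  have hI : I.FG := IsNoetherian.noetherian I
  have := isPrime_idealPLine hI b
  have hne_top := (isPrime_map_mk_idealPYZ I b).ne_top
  rw [map_mk_idealPYZ] at hne_top ⊢
  refine Ideal.height_span_singleton_eq_one_of_mem_nonZeroDivisors ?_ ?_
  · rw [mem_nonZeroDivisors_iff_ne_zero, Ne, Ideal.Quotient.eq_zero_iff_mem]
    exact X_one_notMem_idealPLine hI Ideal.IsPrime.ne_top' b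
  · rwa [Ne, Ideal.span_singleton_eq_top] at hne_top

end idealPLine

section minimalPrimes

variable {R S : Type*} [CommRing R] [CommRing S]

theorem mem_minimalPrimes_of_le_of_le {I J p : Ideal R} (hp : p ∈ I.minimalPrimes) (hIJ : I ≤ J)
    (hJp : J ≤ p) : p ∈ J.minimalPrimes :=
  ⟨⟨hp.1.1, hJp⟩, fun _ hq ↦ hp.2 ⟨hq.1, hIJ.trans hq.2⟩⟩

theorem minimalPrimes_map_inf_subset (f : R →+* S) (I J : Ideal R) :
    ((I ⊓ J).map f).minimalPrimes ⊆ (I.map f).minimalPrimes ∪ (J.map f).minimalPrimes := by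
  intro p hp
  have := hp.1.1
  refine ((Ideal.IsPrime.comap f).inf_le.1 (Ideal.map_le_iff_le_comap.1 hp.1.2)).imp
    (fun h ↦ ?_) fun h ↦ ?_
  · exact mem_minimalPrimes_of_le_of_le hp (Ideal.map_mono inf_le_left)
      (Ideal.map_le_iff_le_comap.2 h)
  · exact mem_minimalPrimes_of_le_of_le hp (Ideal.map_mono inf_le_right)
      (Ideal.map_le_iff_le_comap.2 h)

theorem minimalPrimes_map_iInf_subset {ι : Type*} [Finite ι] (f : R →+* S) (I : ι → Ideal R) :
    ((⨅ i, I i).map f).minimalPrimes ⊆ ⋃ i, ((I i).map f).minimalPrimes := by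
  cases nonempty_fintype ι
  intro p hp
  have := hp.1.1
  obtain ⟨i, -, hi⟩ : ∃ i ∈ Finset.univ, I i ≤ p.comap f := by
    rw [← (Ideal.IsPrime.comap f).inf_le', Finset.inf_univ_eq_iInf]
    exact Ideal.map_le_iff_le_comap.1 hp.1.2
  exact Set.mem_iUnion.2 ⟨i, mem_minimalPrimes_of_le_of_le hp (Ideal.map_mono (iInf_le I i))
    (Ideal.map_le_iff_le_comap.2 hi)⟩

theorem exists_minimalPrimes_map_sup_eq {f : R →+* S} {L : Ideal S}
    (hL : ∀ q : Ideal R, q.IsPrime → (q.map f ⊔ L).IsPrime) {I : Ideal R} {p : Ideal S}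
    (hp : p ∈ (I.map f ⊔ L).minimalPrimes) : ∃ q ∈ I.minimalPrimes, q.map f ⊔ L = p := by
  have := hp.1.1
  obtain ⟨hIp, hLp⟩ := sup_le_iff.1 hp.1.2
  obtain ⟨q, hq, hqp⟩ := Ideal.exists_minimalPrimes_le (Ideal.map_le_iff_le_comap.1 hIp)
  have hle : q.map f ⊔ L ≤ p := sup_le (Ideal.map_le_iff_le_comap.2 hqp) hLp
  exact ⟨q, hq, hle.antisymm <|
    hp.2 ⟨hL q hq.1.1, sup_le_sup_right (Ideal.map_mono hq.1.2) L⟩ hle⟩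

theorem minimalPrimes_map_subset_minimalPrimes [Algebra R S] [Algebra.HasGoingDown R S]
    {p : Ideal R} (hp : p ∈ minimalPrimes R) :
    (p.map (algebraMap R S)).minimalPrimes ⊆ minimalPrimes S := by
  intro q hq
  have := hp.1.1
  have := hq.1.1
  obtain ⟨q', hq'q, hq', hq'p⟩ := Ideal.exists_ideal_le_liesOver_of_le (q := q.under R) q
    (Ideal.map_le_iff_le_comap.1 hq.1.2)
  have hqq' : q' = q := hq'q.antisymm <|
    hq.2 ⟨hq', Ideal.map_le_iff_le_comap.2 hq'p.over.le⟩ hq'q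
  rw [hqq'] at hq'p
  refine ⟨⟨hq.1.1, bot_le⟩, fun r hr hrq ↦ hq.2 ⟨hr.1, Ideal.map_le_iff_le_comap.2 ?_⟩ hrq⟩
  have := hr.1
  refine hp.2 ⟨Ideal.IsPrime.comap _, bot_le⟩ ?_
  rw [hq'p.over]
  exact Ideal.comap_mono hrq

variable [Algebra R S] [Algebra.HasGoingDown R S]
  (hS : ∀ q ∈ minimalPrimes S, IsRegularLocalRing (S ⧸ q)) {P : Ideal R} (hP : P ∈ minimalPrimes R)
include hS hP

theorem isRegularLocalRing_quotient_minimalPrimes_map_idealPYZ {p : Ideal (PowerSeriesYZ S)}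
    (hp : p ∈ ((idealPYZ P).map (MvPowerSeries.map (algebraMap R S))).minimalPrimes) :
    IsRegularLocalRing (PowerSeriesYZ S ⧸ p) := by
  rw [map_idealPYZ] at hp
  obtain ⟨q, hq, rfl⟩ := exists_minimalPrimes_map_sup_eq (fun q _ ↦ isPrime_idealPYZ q) hp
  have := hS q (minimalPrimes_map_subset_minimalPrimes hP hq)
  exact isRegularLocalRing_quotient_idealPYZ q

theorem isRegularLocalRing_quotient_minimalPrimes_map_idealPLine [IsNoetherianRing S] {b : R}
    {p : Ideal (PowerSeriesYZ S)}
    (hp : p ∈ ((idealPLine P b).map (MvPowerSeries.map (algebraMap R S))).minimalPrimes) :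
    IsRegularLocalRing (PowerSeriesYZ S ⧸ p) := by
  rw [map_idealPLine] at hp
  obtain ⟨q, hq, rfl⟩ := exists_minimalPrimes_map_sup_eq
    (fun q _ ↦ isPrime_idealPLine (IsNoetherian.noetherian q) (algebraMap R S b)) hp
  have := hS q (minimalPrimes_map_subset_minimalPrimes hP hq)
  exact isRegularLocalRing_quotient_idealPLine (IsNoetherian.noetherian q) (algebraMap R S b)

end minimalPrimes

theorem IsAdicCompletionMap.completionModMinimalPrimesRegular_quotient {R S : Type*} [CommRing R]
    [IsLocalRing R] [IsNoetherianRing R] [CommRing S] [IsNoetherianRing S] {f : R →+* S}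
    (hf : IsAdicCompletionMap f (IsLocalRing.maximalIdeal R)) {J : Ideal R} [IsLocalRing (R ⧸ J)]
    (hJ : ∀ p ∈ (J.map f).minimalPrimes, IsRegularLocalRing (S ⧸ p)) :
    CompletionModMinimalPrimesRegular (R ⧸ J) := by
  have hquot : IsAdicCompletionMap (Ideal.quotientMap (J.map f) f Ideal.le_comap_map)
      (IsLocalRing.maximalIdeal (R ⧸ J)) := by
    rw [← IsLocalRing.map_maximalIdeal_of_surjective _ Ideal.Quotient.mk_surjective]
    exact hf.of_surjective (ρ := Ideal.Quotient.mk (J.map f)) (Ideal.quotientMap_comp_mk _)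
      Ideal.Quotient.mk_surjective Ideal.Quotient.mk_surjective (by simp)
  intro q hq
  let φ := hquot.adicCompletionEquiv.toRingHom.comp (Ideal.Quotient.mk (J.map f))
  have hφ : Function.Surjective φ :=
    hquot.adicCompletionEquiv.surjective.comp Ideal.Quotient.mk_surjective
  have hφq : Function.Surjective ((Ideal.Quotient.mk q).comp φ) :=
    Ideal.Quotient.mk_surjective.comp hφ
  have hker : RingHom.ker ((Ideal.Quotient.mk q).comp φ) ∈ (J.map f).minimalPrimes := by
    have := Ideal.minimalPrimes_comap_of_surjective hφ hq
    rwa [← RingHom.ker_eq_comap_bot, RingHom.ker_equiv_comp, Ideal.mk_ker, ← Ideal.mk_ker (I := q),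
      RingHom.comap_ker] at this
  have := hJ _ hker
  exact .of_ringEquiv (RingHom.quotientKerEquivOfSurjective hφq)

theorem CompletionModMinimalPrimesRegular.quotient_powerSeriesYZ {B ι κ : Type*} [CommRing B]
    [IsLocalRing B] [IsNoetherianRing B] [Finite ι] [Finite κ]
    (hB : CompletionModMinimalPrimesRegular B) {P : ι → Ideal B} {P' : κ → Ideal B}
    (hP : ∀ i, P i ∈ minimalPrimes B) (hP' : ∀ j, P' j ∈ minimalPrimes B) (b : ι → B)
    [IsLocalRing (PowerSeriesYZ B ⧸ (⨅ i, idealPLine (P i) (b i)) ⊓ ⨅ j, idealPYZ (P' j))] :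
    CompletionModMinimalPrimesRegular
      (PowerSeriesYZ B ⧸ (⨅ i, idealPLine (P i) (b i)) ⊓ ⨅ j, idealPYZ (P' j)) := by
  have := isNoetherianRing_adicCompletion (IsLocalRing.maximalIdeal B)
  have hcompl := (IsAdicCompletionMap.algebraMap_adicCompletion
    (IsNoetherian.noetherian (IsLocalRing.maximalIdeal B))).mvPowerSeries (σ := Fin 2)
  rw [comap_constantCoeff_maximalIdeal] at hcompl
  refine hcompl.completionModMinimalPrimesRegular_quotient fun p hp ↦ ?_
  obtain hp | hp := minimalPrimes_map_inf_subset _ _ _ hp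
  · obtain ⟨i, hp⟩ := Set.mem_iUnion.1 (minimalPrimes_map_iInf_subset _ _ hp)
    exact isRegularLocalRing_quotient_minimalPrimes_map_idealPLine hB (hP i) hp
  · obtain ⟨j, hp⟩ := Set.mem_iUnion.1 (minimalPrimes_map_iInf_subset _ _ hp)
    exact isRegularLocalRing_quotient_minimalPrimes_map_idealPYZ hB (hP' j) hp

theorem mainTheorem4_general {B ι κ : Type*} [CommRing B] [IsLocalRing B] [IsNoetherianRing B]
    [Finite ι] [Nonempty ι] (hB : CompletionModMinimalPrimesRegular B) {P : κ → Ideal B}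
    (hP : Function.Injective P) (hPmin : ∀ j, P j ∈ minimalPrimes B) (j₀ : κ) {b : ι → B}
    (hb : Function.Injective fun i ↦ Ideal.Quotient.mk (P j₀) (b i)) :
    (∀ i, (idealPLine (P j₀) (b i)).IsPrime) ∧
      Function.Injective (fun i ↦ idealPLine (P j₀) (b i)) ∧
      (∀ i j, idealPLine (P j₀) (b i) ≤ idealPYZ (P j) ↔ j = j₀) ∧
      (∀ i, ((idealPYZ (P j₀)).map (Ideal.Quotient.mk (idealPLine (P j₀) (b i)))).IsPrime ∧
        ((idealPYZ (P j₀)).map (Ideal.Quotient.mk (idealPLine (P j₀) (b i)))).height = 1) ∧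
      ∀ J : Ideal (PowerSeriesYZ B),
        J = (⨅ i, idealPLine (P j₀) (b i)) ⊓ (⨅ j, ⨅ (_ : j ≠ j₀), idealPYZ (P j)) →
        ∃ (_ : IsLocalRing (PowerSeriesYZ B ⧸ J)) (_ : IsNoetherianRing (PowerSeriesYZ B ⧸ J)),
          CompletionModMinimalPrimesRegular (PowerSeriesYZ B ⧸ J) := by
  have : (P j₀).IsPrime := (hPmin j₀).1.1
  have hfg : (P j₀).FG := IsNoetherian.noetherian (P j₀)
  have hQ (i : ι) : (idealPLine (P j₀) (b i)).IsPrime := isPrime_idealPLine hfg (b i)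
  refine ⟨hQ, fun i i' h ↦ hb ?_, fun i j ↦ ?_, fun i ↦
    ⟨isPrime_map_mk_idealPYZ _ _, height_map_mk_idealPYZ _ _⟩, ?_⟩
  · exact Ideal.Quotient.eq.2 (sub_mem_of_idealPLine_le_idealPLine hfg h.le)
  · have := (hPmin j).1
    rw [idealPLine_le_idealPYZ_iff]
    exact ⟨fun h ↦ hP (((hPmin j).2 (hPmin j₀).1 h).antisymm h), fun h ↦ h ▸ le_rfl⟩
  · intro J hJ
    rw [iInf_subtype'] at hJ
    have hJQ (i : ι) : J ≤ idealPLine (P j₀) (b i) := hJ ▸ inf_le_of_left_le (iInf_le _ i)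
    have hJ_top : J ≠ ⊤ := ‹Nonempty ι›.elim fun i ↦ ne_top_of_le_ne_top (hQ i).ne_top (hJQ i)
    have := Ideal.Quotient.nontrivial_iff.2 hJ_top
    have hloc := IsLocalRing.of_surjective' (Ideal.Quotient.mk J) Ideal.Quotient.mk_surjective
    have := (minimalPrimes.finite_of_isNoetherianRing B).to_subtype
    have : Finite κ := .of_injective _ (hP.codRestrict hPmin)
    subst hJ
    exact ⟨hloc, inferInstance, hB.quotient_powerSeriesYZ (fun _ ↦ hPmin j₀)
      (fun j : {j // j ≠ j₀} ↦ hPmin j) b⟩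

theorem mainTheorem4 {B K : Type*} [CommRing B] [IsLocalRing B] [IsNoetherianRing B]
    [Field K] [Infinite K] [Algebra K B]
    (hB : CompletionModMinimalPrimesRegular B)
    (m : ℕ) [NeZero m] (P : Fin m → Ideal B) (hP : Function.Injective P)
    (hPmin : Set.range P = minimalPrimes B)
    (n : ℕ) (hn : 0 < n) :
    ∃ (β : Fin n → K) (Q : Fin n → Ideal (PowerSeriesYZ B)),
      Function.Injective β ∧
      (∀ i, Q i = idealPLine (P 0) (algebraMap K B (β i))) ∧
      (∀ i, (Q i).IsPrime) ∧
      Function.Injective Q ∧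
      (∀ i j, Q i ≤ idealPYZ (P j) ↔ j = 0) ∧
      (∀ i, ((idealPYZ (P 0)).map (Ideal.Quotient.mk (Q i))).IsPrime ∧
        ((idealPYZ (P 0)).map (Ideal.Quotient.mk (Q i))).height = 1) ∧
      ∀ J : Ideal (PowerSeriesYZ B),
        J = (⨅ i, Q i) ⊓ (⨅ j, ⨅ (_ : j ≠ 0), idealPYZ (P j)) →
        ∃ (_ : IsLocalRing (PowerSeriesYZ B ⧸ J)) (_ : IsNoetherianRing (PowerSeriesYZ B ⧸ J)),
          CompletionModMinimalPrimesRegular (PowerSeriesYZ B ⧸ J) := by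
  have hmin (j : Fin m) : P j ∈ minimalPrimes B := hPmin ▸ Set.mem_range_self j
  have : (P 0).IsPrime := (hmin 0).1.1
  have : Nonempty (Fin n) := ⟨⟨0, hn⟩⟩
  let β : Fin n ↪ K := Fin.valEmbedding.trans (Infinite.natEmbedding K)
  have hβ : Function.Injective fun i ↦ Ideal.Quotient.mk (P 0) (algebraMap K B (β i)) :=
    ((Ideal.Quotient.mk (P 0)).comp (algebraMap K B)).injective.comp β.injective
  exact ⟨β, _, β.injective, fun _ ↦ rfl, mainTheorem4_general hB hP hmin 0 hβ⟩
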